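/- Theorem (Solvability of the SGTR design problem). Consider a plant $\dot x = Ax+Bu+B_d d$, $e = Cx+Du+D_d d$ with real matrices, state $x\in\mathbb{R}^n$, input $u\in\mathbb{R}^m$, error $e\in\mathbb{R}^r$, where $A$ is Hurwitz (all its eigenvalues have negative real part), and let $\hat P(s)=C(sI_n-A)^{-1}B+D$. Let $d$ be generated by an exosystem $\dot w=Sw$, $d=Ew$, where the real matrix $S$ has minimal polynomial $\mu_S(s)=s(s^2+\omega_1^2)\cdots(s^2+\omega_\ell^2)$ with $\ell \ge 0$ and $0<\omega_1<\cdots<\omega_\ell$. Put $\lambda_0=0$, $\lambda_k=\mathrm{j}\omega_k$ for $1\le k\le\ell$, and $q=2\ell+1$. Let $$\phi=\mathrm{blkdiag}\Big(0,\begin{bmatrix}0&1\\-\omega_1^2&0\end{bmatrix},\ldots,\begin{bmatrix}0&1\\-\omega_\ell^2&0\end{bmatrix}\Big)\in\mathbb{R}^{q\times q},\qquad g=(1,0,1,\ldots,0,1)^{\mathsf T}\in\mathbb{R}^{q},$$ $\Phi=\phi\otimes I_r$ and $G=g\otimes I_r$. For $F:\mathbb{R}_{\ge0}\to\mathbb{R}^{m\times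 rq}$, the closed loop of the plant with the single-gain tuning regulator $\dot\eta=\Phi\eta+Ge$, $u=-F(\epsilon)\eta$ has the system matrix $$\mathcal{A}(\epsilon)=\begin{bmatrix}A&-BF(\epsilon)\\ GC&\Phi-GDF(\epsilon)\end{bmatrix}.$$ Let $\mathcal F$ be the class of continuous $F:\mathbb{R}_{\ge0}\to\mathbb{R}^{m\times rq}$ which are $\mathcal{O}(\epsilon)$ as $\epsilon\to0^+$, in the sense that $\lim_{\epsilon\to0^+}\|F(\epsilon)\|/\epsilon$ exists and is finite ($\|\cdot\|$ being the spectral norm). A continuous square-matrix-valued function $\mathcal{A}$ on $\mathbb{R}_{\ge 0}$ is low-gain Hurwitz stable if there are $c,\epsilon^*>0$ such that $\max_{\lambda\in\mathrm{eig}(\mathcal{A}(\epsilon))}\mathrm{Re}\,\lambda\le -c\,\epsilon$ for all $\epsilon\in[0,\epsilon^*)$ (the maximum over the empty set being $-\infty$). If $\mathrm{rank}\,\hat P(\lambda)=r$ for every eigenvalue $\lambda$ of $S$, then the following design problem is solvable: given $\mu_S$ and the frequency response samples $\hat P(\lambda_k)$, $k=0,\ldots,\ell$, of the otherwise unknown plant,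 find $F\in\mathcal F$ such that the closed-loop matrix $\mathcal{A}$ is low-gain Hurwitz stable. That is, there is an $F\in\mathcal F$, determined by these data alone, such that for every plant of any order with the same numbers of inputs and error variables, with Hurwitz state matrix and with the same samples $\hat P(\lambda_k)$ (in particular for the given plant) the closed-loop matrix with this $F$ is low-gain Hurwitz stable. (The constants $c,\epsilon^*$ may depend on the plant.) -/

import Mathlib

open scoped NNReal Kronecker Topology

noncomputable section

namespace SGTR

/-- The spectral abscissa `α(M) = max {Re λ : λ ∈ eig(M)}` of a real square matrix, where `eig(M)`
is the set of complex eigenvalues. It is taken in the extended reals, so that the (empty) maximum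
for a `0 × 0` matrix is `-∞`. -/
def spectralAbscissa {ι : Type*} [Fintype ι] [DecidableEq ι] (M : Matrix ι ι ℝ) : EReal :=
  ⨆ μ ∈ spectrum ℂ (M.map Complex.ofReal), ((μ.re : ℝ) : EReal)

/-- All complex eigenvalues lie in the open left half plane. -/
def IsHurwitz {ι : Type*} [Fintype ι] [DecidableEq ι] (M : Matrix ι ι ℝ) : Prop :=
  ∀ μ ∈ spectrum ℂ (M.map Complex.ofReal), μ.re < 0

/-- Low-gain Hurwitz stability of a matrix-valued function of `ε ≥ 0`: it is continuous, and
`α(M(ε)) ≤ -c ε` on some interval `[0, ε*)`, for constants `c, ε* > 0`. -/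
def LowGainHurwitz {ι : Type*} [Fintype ι] [DecidableEq ι] (M : ℝ≥0 → Matrix ι ι ℝ) : Prop :=
  Continuous M ∧ ∃ c : ℝ, 0 < c ∧ ∃ εs : ℝ≥0, 0 < εs ∧
    ∀ ε : ℝ≥0, ε < εs → spectralAbscissa (M ε) ≤ ((-(c * (ε : ℝ)) : ℝ) : EReal)

open scoped Matrix.Norms.L2Operator in
/-- The class of gains: continuous maps `F` on `[0, ∞)` for which the limit of `‖F(ε)‖ / ε`
as `ε → 0⁺` exists and is finite (the norm is the spectral norm). -/
def IsLowGain {ι κ : Type*} [Fintype ι] [Fintype κ] [DecidableEq κ]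
    (F : ℝ≥0 → Matrix ι κ ℝ) : Prop :=
  Continuous F ∧
    ∃ L : ℝ, Filter.Tendsto (fun ε : ℝ≥0 => ‖F ε‖ / (ε : ℝ)) (𝓝[>] 0) (𝓝 L)

/-- The plant matrices on the channel from `u` to `e`:
`ẋ = A x + B u`, `e = C x + D u`, with `n` states, `m` inputs and `r` outputs. -/
structure Plant (n m r : ℕ) where
  A : Matrix (Fin n) (Fin n) ℝ
  B : Matrix (Fin n) (Fin m) ℝ
  C : Matrix (Fin r) (Fin n) ℝ
  D : Matrix (Fin r) (Fin m) ℝ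

/-- The transfer matrix `P̂(s) = C (s I - A)⁻¹ B + D`. -/
def Plant.transfer {n m r : ℕ} (P : Plant n m r) (s : ℂ) : Matrix (Fin r) (Fin m) ℂ :=
  P.C.map Complex.ofReal * (s • (1 : Matrix (Fin n) (Fin n) ℂ) - P.A.map Complex.ofReal)⁻¹ *
    P.B.map Complex.ofReal + P.D.map Complex.ofReal

/-- `s (s² + ω₁²) ⋯ (s² + ω_ℓ²)`. -/
def exoPolynomial {ℓ : ℕ} (ω : Fin ℓ → ℝ) : Polynomial ℝ :=
  Polynomial.X * ∏ k : Fin ℓ, (Polynomial.X ^ 2 + Polynomial.C (ω k ^ 2))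

/-- The sampling points: `λ₀ = 0` and `λ_k = j ω_k` for `k = 1, …, ℓ`. -/
def exoEigenvalue {ℓ : ℕ} (ω : Fin ℓ → ℝ) : Fin (ℓ + 1) → ℂ :=
  Fin.cons 0 fun k => Complex.I * (ω k : ℂ)

/-- Index type of the `q = 1 + 2ℓ` coordinates of `φ`: one for the constant mode, and the `i`-th
coordinate (`i : Fin 2`) of the `k`-th oscillator (`k : Fin ℓ`). -/
abbrev ModeIndex (ℓ : ℕ) : Type := Fin 1 ⊕ (Fin 2 × Fin ℓ)

/-- `φ = blkdiag(0, φ₁, …, φ_ℓ)` with `φ_k = [0, 1; -ω_k², 0]`. -/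
def phi {ℓ : ℕ} (ω : Fin ℓ → ℝ) : Matrix (ModeIndex ℓ) (ModeIndex ℓ) ℝ :=
  Matrix.fromBlocks 0 0 0 (Matrix.blockDiagonal fun k : Fin ℓ => !![0, 1; -(ω k) ^ 2, 0])

/-- `g = col(1, g₁, …, g_ℓ)` with `g_k = [0; 1]`. -/
def gCol (ℓ : ℕ) : ModeIndex ℓ → ℝ :=
  Sum.elim (fun _ => 1) fun p => ![0, 1] p.1

/-- `Φ = φ ⊗ I_r`. -/
def bigPhi {ℓ : ℕ} (r : ℕ) (ω : Fin ℓ → ℝ) :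
    Matrix (ModeIndex ℓ × Fin r) (ModeIndex ℓ × Fin r) ℝ :=
  phi ω ⊗ₖ (1 : Matrix (Fin r) (Fin r) ℝ)

/-- `G = g ⊗ I_r`, as a matrix with `r` columns. -/
def bigG (ℓ r : ℕ) : Matrix (ModeIndex ℓ × Fin r) (Fin r) ℝ :=
  Matrix.of fun p j => gCol ℓ p.1 * (1 : Matrix (Fin r) (Fin r) ℝ) p.2 j

/-- State matrix of the interconnection of the plant with `η̇ = Φ η + G e`, `u = -K η`. -/
def closedLoop {n m r ℓ : ℕ} (P : Plant n m r) (ω : Fin ℓ → ℝ)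
    (K : Matrix (Fin m) (ModeIndex ℓ × Fin r) ℝ) :
    Matrix (Fin n ⊕ ModeIndex ℓ × Fin r) (Fin n ⊕ ModeIndex ℓ × Fin r) ℝ :=
  Matrix.fromBlocks P.A (-(P.B * K)) (bigG ℓ r * P.C) (bigPhi r ω - bigG ℓ r * P.D * K)

/-- Solvability of the single-gain tuning regulator problem for given exosystem frequencies `ω` and
given frequency response samples `H k` at the points `λ_k`. The gain is designed from these data
alone, the plant being otherwise unknown: one gain `F` has to make the closed loop low-gain Hurwitz
stable for every Hurwitz plant, of any order, with these samples. -/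
def ProblemSolvable {m r ℓ : ℕ} (ω : Fin ℓ → ℝ)
    (H : Fin (ℓ + 1) → Matrix (Fin r) (Fin m) ℂ) : Prop :=
  ∃ F : ℝ≥0 → Matrix (Fin m) (ModeIndex ℓ × Fin r) ℝ, IsLowGain F ∧
    ∀ (n : ℕ) (P : Plant n m r), IsHurwitz P.A →
      (∀ k, P.transfer (exoEigenvalue ω k) = H k) →
      LowGainHurwitz fun ε => closedLoop P ω (F ε)

end SGTR

end

namespace SGTR

open Matrix Filter

/-! The gain is `ε • K` with `K = sampleGain ω H` a fixed real matrix. If stability fails, some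
eigenpairs `(μᵢ, zᵢ)` of the closed loop have `Re μᵢ > -εᵢ/(i+1)` with `εᵢ → 0`. By compactness they
converge along a subsequence to an eigenpair `(μ₀, z₀)` of the uncoupled loop with `Re μ₀ ≥ 0`.
Since `A` is Hurwitz, `z₀` lives on a single regulator mode, with direction `w ≠ 0` and `μ₀ = 0` or
`μ₀ = ±jω_k` (`eigenvector_zero_gain`). Eliminating the plant state (`Plant.output_eq`) gives `(μᵢ²
+ ω_k²) yᵢ = -εᵢ P̂(μᵢ) K ηᵢ` for the first coordinate `yᵢ` of that mode. Because `K` acts on the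
limit mode as `2μ₀ P̂(μ₀)ᴴ`, pairing with `w` yields `(μᵢ - μ₀)/εᵢ → -|P̂(μ₀)ᴴ w|²/|w|²`. The
constant mode is analogous. Full row rank makes this limit negative, contradicting the slow decay
(`no_slow_eigenpairs`). Only the samples enter `K`, so the same gain serves every plant sharing
them. -/

theorem exists_eigenvector_of_mem_spectrum {ι : Type*} [Fintype ι] [DecidableEq ι]
    {M : Matrix ι ι ℂ} {μ : ℂ} (h : μ ∈ spectrum ℂ M) :
    ∃ v : ι → ℂ, ‖v‖ = 1 ∧ M *ᵥ v = μ • v := by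
  rw [← Matrix.spectrum_toLin', ← Module.End.hasEigenvalue_iff_mem_spectrum] at h
  obtain ⟨v, hv⟩ := h.exists_hasEigenvector
  have hn : ‖v‖ ≠ 0 := norm_ne_zero_iff.2 hv.2
  refine ⟨((‖v‖⁻¹ : ℝ) : ℂ) • v, ?_, ?_⟩
  · rw [norm_smul, Complex.norm_real, norm_inv, norm_norm, inv_mul_cancel₀ hn]
  · rw [Matrix.mulVec_smul, smul_comm, ← hv.apply_eq_smul, Matrix.toLin'_apply]

theorem mem_spectrum_iff_det_eq_zero {ι : Type*} [Fintype ι] [DecidableEq ι]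
    {M : Matrix ι ι ℂ} {μ : ℂ} :
    μ ∈ spectrum ℂ M ↔ (μ • (1 : Matrix ι ι ℂ) - M).det = 0 := by
  rw [spectrum.mem_iff, Algebra.algebraMap_eq_smul_one, Matrix.isUnit_iff_isUnit_det,
    isUnit_iff_ne_zero, not_not]

theorem tendsto_mulVec {α ι κ : Type*} [Fintype κ] {l : Filter α} {M : α → Matrix ι κ ℂ}
    {M₀ : Matrix ι κ ℂ} {v : α → κ → ℂ} {v₀ : κ → ℂ} (hM : Tendsto M l (𝓝 M₀))
    (hv : Tendsto v l (𝓝 v₀)) : Tendsto (fun i => M i *ᵥ v i) l (𝓝 (M₀ *ᵥ v₀)) := by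
  have hentry : ∀ a b, Tendsto (fun i => M i a b) l (𝓝 (M₀ a b)) := fun a b =>
    tendsto_pi_nhds.1 (tendsto_pi_nhds.1 hM a) b
  exact tendsto_pi_nhds.2 fun a => tendsto_finsetSum _ fun b _ =>
    (hentry a b).mul (tendsto_pi_nhds.1 hv b)

theorem isOpen_resolventSet_matrix {ι : Type*} [Fintype ι] [DecidableEq ι] (M : Matrix ι ι ℂ) :
    IsOpen {μ : ℂ | μ ∉ spectrum ℂ M} := by
  simp only [mem_spectrum_iff_det_eq_zero]
  exact isOpen_ne_fun (by fun_prop) continuous_const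

/-! ### Exosystem eigenvalues and the rank condition. -/

theorem mem_spectrum_of_isRoot_minpoly {ι : Type*} [Fintype ι] [DecidableEq ι]
    {S : Matrix ι ι ℝ} {μ : ℂ} (h : Polynomial.aeval μ (minpoly ℝ S) = 0) :
    μ ∈ spectrum ℂ (S.map Complex.ofReal) := by
  rw [Matrix.mem_spectrum_iff_isRoot_charpoly]
  have := Matrix.charpoly_map S Complex.ofRealHom
  change (S.map Complex.ofRealHom).charpoly.IsRoot μ
  rw [this, Polynomial.IsRoot.def, Polynomial.eval_map]
  obtain ⟨q, hq⟩ := Matrix.minpoly_dvd_charpoly S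
  rw [hq, Polynomial.eval₂_mul]
  have h' : Polynomial.eval₂ Complex.ofRealHom μ (minpoly ℝ S) = 0 := h
  rw [h', zero_mul]

theorem aeval_exoEigenvalue {ℓ : ℕ} (ω : Fin ℓ → ℝ) (k : Fin (ℓ + 1)) :
    Polynomial.aeval (exoEigenvalue ω k) (exoPolynomial ω) = 0 := by
  refine Fin.cases ?_ (fun k => ?_) k
  · simp [exoEigenvalue, exoPolynomial]
  · have : Polynomial.aeval (exoEigenvalue ω k.succ) (Polynomial.X ^ 2 + Polynomial.C (ω k ^ 2))
        = 0 := by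
      simp [exoEigenvalue, mul_pow]
    rw [exoPolynomial, map_mul, map_prod, Finset.prod_eq_zero (Finset.mem_univ k) this, mul_zero]

open scoped ComplexOrder in
theorem rank_map_star {r m : ℕ} (H : Matrix (Fin r) (Fin m) ℂ) : (H.map star).rank = H.rank := by
  rw [← Matrix.rank_transpose]
  exact Matrix.rank_conjTranspose H

/-- Rank-nullity for `Hᴴ`, whose rank equals that of `H`. This is the only way in which the rank
hypothesis is used. -/
theorem eq_zero_of_conjTranspose_mulVec {r m : ℕ} {H : Matrix (Fin r) (Fin m) ℂ}
    (hH : H.rank = r) {w : Fin r → ℂ} (hw : Hᴴ *ᵥ w = 0) : w = 0 := by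
  have h1 := LinearMap.finrank_range_add_finrank_ker (Hᴴ).mulVecLin
  have h2 : Module.finrank ℂ (LinearMap.range (Hᴴ).mulVecLin) = r := by
    exact (Matrix.rank_transpose (H.map star)).trans ((rank_map_star H).trans hH)
  rw [h2, Module.finrank_fin_fun] at h1
  have h3 : LinearMap.ker (Hᴴ).mulVecLin = ⊥ := Submodule.finrank_eq_zero.1 (by omega)
  exact LinearMap.ker_eq_bot'.1 h3 w hw

open scoped ComplexOrder in
theorem star_dotProduct_self_pos {ι : Type*} [Fintype ι] {w : ι → ℂ} (hw : w ≠ 0) :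
    ∃ t : ℝ, 0 < t ∧ star w ⬝ᵥ w = t := by
  have h : 0 < star w ⬝ᵥ w := dotProduct_star_self_pos_iff.2 hw
  obtain ⟨h1, h2⟩ := Complex.pos_iff.1 h
  exact ⟨_, h1, Complex.ext rfl (by simp [← h2])⟩

/-! ### The transfer matrix. -/

namespace Plant

variable {n m r : ℕ} (P : Plant n m r)

/-- The plant matrices are real. Hence the sample at `0` is real, and samples at `jω_k` also
determine the response at `-jω_k`. -/
theorem transfer_star (s : ℂ) : P.transfer (star s) = (P.transfer s).map star := by
  have hreal : ∀ {a b : ℕ} (M : Matrix (Fin a) (Fin b) ℝ),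
      (M.map Complex.ofReal).map (starRingEnd ℂ) = M.map Complex.ofReal := by
    intro a b M; ext i j; simp
  have hinv : ∀ M : Matrix (Fin n) (Fin n) ℂ,
      (M.map (starRingEnd ℂ))⁻¹ = M⁻¹.map (starRingEnd ℂ) := by
    intro M
    have := Matrix.conjTranspose_nonsing_inv M
    have h2 := Matrix.transpose_nonsing_inv (M.map (starRingEnd ℂ))
    apply Matrix.transpose_injective
    rw [h2]
    exact this.symm
  change _ = (P.transfer s).map (starRingEnd ℂ)
  unfold transfer
  rw [Matrix.map_add _ (map_add _), Matrix.map_mul, Matrix.map_mul, hreal, hreal, hreal, ← hinv,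
    Matrix.map_sub _ (map_sub _), hreal]
  congr 5
  ext i j
  by_cases h : i = j <;> simp [h]

theorem continuousAt_transfer {s : ℂ} (hs : s ∉ spectrum ℂ (P.A.map Complex.ofReal)) :
    ContinuousAt P.transfer s := by
  have hd := mem_spectrum_iff_det_eq_zero.not.1 hs
  have hc : Continuous fun s : ℂ => s • (1 : Matrix (Fin n) (Fin n) ℂ) - P.A.map Complex.ofReal := by
    fun_prop
  have hi : ContinuousAt
      (fun s : ℂ => (s • (1 : Matrix (Fin n) (Fin n) ℂ) - P.A.map Complex.ofReal)⁻¹) s := by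
    simp only [Matrix.inv_def, Ring.inverse_eq_inv']
    exact (hc.matrix_det.continuousAt.inv₀ hd).smul hc.matrix_adjugate.continuousAt
  unfold transfer
  have h1 : Continuous fun X : Matrix (Fin n) (Fin n) ℂ => P.C.map Complex.ofReal * X *
    P.B.map Complex.ofReal + P.D.map Complex.ofReal := by fun_prop
  exact h1.continuousAt.comp hi

/-- The steady-state output relation: if `A x - B u = s x`, then `C x - D u = -P̂(s) u`. -/
theorem output_eq {s : ℂ} (hs : s ∉ spectrum ℂ (P.A.map Complex.ofReal))
    {x : Fin n → ℂ} {u : Fin m → ℂ}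
    (h : P.A.map Complex.ofReal *ᵥ x - P.B.map Complex.ofReal *ᵥ u = s • x) :
    P.C.map Complex.ofReal *ᵥ x - P.D.map Complex.ofReal *ᵥ u = -(P.transfer s *ᵥ u) := by
  have hd := mem_spectrum_iff_det_eq_zero.not.1 hs
  set M := s • (1 : Matrix (Fin n) (Fin n) ℂ) - P.A.map Complex.ofReal with hM
  have h1 : M *ᵥ x = -(P.B.map Complex.ofReal *ᵥ u) := by
    rw [hM, Matrix.sub_mulVec, Matrix.smul_mulVec, Matrix.one_mulVec, ← h]
    abel
  have h2 : x = -(M⁻¹ *ᵥ (P.B.map Complex.ofReal *ᵥ u)) := by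
    rw [← Matrix.mulVec_neg, ← h1, Matrix.mulVec_mulVec,
      Matrix.nonsing_inv_mul _ (isUnit_iff_ne_zero.2 hd), Matrix.one_mulVec]
  rw [transfer, ← hM, Matrix.add_mulVec, ← Matrix.mulVec_mulVec, ← Matrix.mulVec_mulVec, h2,
    Matrix.mulVec_neg]
  abel

end Plant

/-- The eigenvector equations of the closed loop, written out along the coordinates of the plant
and of the modes of the regulator. -/
theorem closedLoop_eigenvector {n m r ℓ : ℕ} (P : Plant n m r) (ω : Fin ℓ → ℝ)
    (K : Matrix (Fin m) (ModeIndex ℓ × Fin r) ℝ) {μ : ℂ}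
    {z : Fin n ⊕ ModeIndex ℓ × Fin r → ℂ}
    (h : (closedLoop P ω K).map Complex.ofReal *ᵥ z = μ • z)
    {u : Fin m → ℂ} (hu : K.map Complex.ofReal *ᵥ (z ∘ Sum.inr) = u)
    {e : Fin r → ℂ}
    (he : P.C.map Complex.ofReal *ᵥ (z ∘ Sum.inl) - P.D.map Complex.ofReal *ᵥ u = e) :
    P.A.map Complex.ofReal *ᵥ (z ∘ Sum.inl) - P.B.map Complex.ofReal *ᵥ u = μ • (z ∘ Sum.inl) ∧
    (∀ j, μ * z (Sum.inr (Sum.inl 0, j)) = e j) ∧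
    (∀ k j, μ * z (Sum.inr (Sum.inr (0, k), j)) = z (Sum.inr (Sum.inr (1, k), j))) ∧
    (∀ k j, μ * z (Sum.inr (Sum.inr (1, k), j)) =
      -(ω k : ℂ) ^ 2 * z (Sum.inr (Sum.inr (0, k), j)) + e j) := by
  have hmul : ∀ {α β γ : Type} [Fintype β] (M : Matrix α β ℝ) (N : Matrix β γ ℝ),
      (M * N).map Complex.ofReal = M.map Complex.ofReal * N.map Complex.ofReal :=
    fun M N => Matrix.map_mul (f := Complex.ofRealHom)
  have hneg : ∀ {α β : Type} (M : Matrix α β ℝ),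
      (-M).map Complex.ofReal = -M.map Complex.ofReal := by
    intro α β M; ext; simp
  have hsub : ∀ {α β : Type} (M N : Matrix α β ℝ),
      (M - N).map Complex.ofReal = M.map Complex.ofReal - N.map Complex.ofReal := by
    intro α β M N; ext; simp
  rw [closedLoop, Matrix.fromBlocks_map, Matrix.fromBlocks_mulVec] at h
  have h1 := congrArg (fun f => f ∘ Sum.inl) h
  have h2 := congrArg (fun f => f ∘ Sum.inr) h
  simp only [Sum.elim_comp_inl, Sum.elim_comp_inr] at h1 h2
  rw [hneg, hmul, Matrix.neg_mulVec, ← Matrix.mulVec_mulVec, hu] at h1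
  rw [hsub, hmul, hmul, hmul, Matrix.sub_mulVec, ← Matrix.mulVec_mulVec, ← Matrix.mulVec_mulVec,
    ← Matrix.mulVec_mulVec, hu, add_sub_left_comm, ← Matrix.mulVec_sub, he] at h2
  have hG : ∀ p, ((bigG ℓ r).map Complex.ofReal *ᵥ e) p = gCol ℓ p.1 * e p.2 := by
    intro p
    simp [Matrix.mulVec, dotProduct, bigG, Matrix.one_apply, apply_ite Complex.ofReal]
  have hPhi : ∀ p, ((bigPhi r ω).map Complex.ofReal *ᵥ (z ∘ Sum.inr)) p =
      ∑ q, phi ω p.1 q * z (Sum.inr (q, p.2)) := by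
    intro p
    simp [Matrix.mulVec, dotProduct, bigPhi, Matrix.one_apply, Fintype.sum_prod_type,
      Matrix.kroneckerMap_apply, apply_ite Complex.ofReal]
  have h3 : ∀ p : ModeIndex ℓ × Fin r, μ * z (Sum.inr p) =
      ∑ q, phi ω p.1 q * z (Sum.inr (q, p.2)) + gCol ℓ p.1 * e p.2 := by
    intro p
    rw [← hPhi, ← hG]
    exact (congrFun h2 p).symm
  refine ⟨by rw [sub_eq_add_neg]; exact h1, fun j => ?_, fun k j => ?_, fun k j => ?_⟩
  · rw [h3]
    simp [phi, gCol]
  · rw [h3]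
    simp [phi, gCol, Fintype.sum_prod_type, Matrix.blockDiagonal_apply, apply_ite Complex.ofReal]
  · rw [h3]
    simp [phi, gCol, Fintype.sum_prod_type, Matrix.blockDiagonal_apply, apply_ite Complex.ofReal]

/-! ### The gain and its action on the modes. -/

/-- The gain matrix built from the frequency response samples: on the mode `λ_k` it reduces to
`2 λ_k P̂(λ_k)ᴴ` (and to `P̂(0)ᴴ` on the constant mode). -/
def sampleGain {m r ℓ : ℕ} (ω : Fin ℓ → ℝ) (H : Fin (ℓ + 1) → Matrix (Fin r) (Fin m) ℂ) :
    Matrix (Fin m) (ModeIndex ℓ × Fin r) ℝ :=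
  Matrix.of fun i p => Sum.elim (fun _ => (H 0 p.2 i).re)
    (fun q => ![2 * ω q.2 * (H q.2.succ p.2 i).im, 2 * (H q.2.succ p.2 i).re] q.1) p.1

theorem sampleGain_mulVec {m r ℓ : ℕ} (ω : Fin ℓ → ℝ)
    (H : Fin (ℓ + 1) → Matrix (Fin r) (Fin m) ℂ) (y : ModeIndex ℓ × Fin r → ℂ) (i : Fin m) :
    ((sampleGain ω H).map Complex.ofReal *ᵥ y) i =
      ∑ j, ((H 0 j i).re : ℂ) * y (Sum.inl 0, j) +
      ∑ k, ∑ j, (2 * ω k * (H k.succ j i).im * y (Sum.inr (0, k), j) +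
        2 * (H k.succ j i).re * y (Sum.inr (1, k), j)) := by
  simp [Matrix.mulVec, dotProduct, sampleGain, Fintype.sum_prod_type, Finset.sum_add_distrib]

theorem sampleGain_mulVec_constant {m r ℓ : ℕ} (ω : Fin ℓ → ℝ)
    (H : Fin (ℓ + 1) → Matrix (Fin r) (Fin m) ℂ) (hH : (H 0).map star = H 0)
    {y : ModeIndex ℓ × Fin r → ℂ} (hy : ∀ i k j, y (Sum.inr (i, k), j) = 0) :
    (sampleGain ω H).map Complex.ofReal *ᵥ y = (H 0)ᴴ *ᵥ fun j => y (Sum.inl 0, j) := by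
  ext i
  rw [sampleGain_mulVec]
  simp only [hy, mul_zero, add_zero, Finset.sum_const_zero]
  refine Finset.sum_congr rfl fun j _ => ?_
  have : star (H 0 j i) = H 0 j i := congrFun (congrFun hH j) i
  change _ = star (H 0 j i) * _
  rw [this, Complex.conj_eq_iff_re.1 this]

/-- With `s = ±jω` the real coefficients combine as `2ω Im h + 2s Re h = 2s·star N`, where `N` is
`h` or its conjugate; one real gain thus serves both conjugate eigenvalues. -/
theorem sampleGain_mulVec_oscillator {m r ℓ : ℕ} (ω : Fin ℓ → ℝ)
    (H : Fin (ℓ + 1) → Matrix (Fin r) (Fin m) ℂ) (k : Fin ℓ) {s : ℂ}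
    {N : Matrix (Fin r) (Fin m) ℂ}
    (hs : s = Complex.I * ω k ∧ N = H k.succ ∨
      s = star (Complex.I * ω k) ∧ N = (H k.succ).map star)
    {y : ModeIndex ℓ × Fin r → ℂ} (hy0 : ∀ j, y (Sum.inl 0, j) = 0)
    (hy : ∀ i k', k' ≠ k → ∀ j, y (Sum.inr (i, k'), j) = 0)
    (hy1 : ∀ j, y (Sum.inr (1, k), j) = s * y (Sum.inr (0, k), j)) :
    (sampleGain ω H).map Complex.ofReal *ᵥ y =
      (2 * s) • (Nᴴ *ᵥ fun j => y (Sum.inr (0, k), j)) := by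
  ext i
  rw [sampleGain_mulVec, Finset.sum_eq_single k (fun k' _ hk' => by simp [hy _ k' hk'])
    (by simp)]
  simp only [hy0, mul_zero, Finset.sum_const_zero, zero_add, hy1, Pi.smul_apply, Matrix.mulVec,
    dotProduct, smul_eq_mul, Matrix.conjTranspose_apply]
  rw [Finset.mul_sum]
  refine Finset.sum_congr rfl fun j _ => ?_
  have hfac : 2 * (ω k : ℂ) * (H k.succ j i).im + 2 * (H k.succ j i).re * s =
      2 * s * star (N j i) := by
    obtain ⟨rfl, rfl⟩ | ⟨rfl, rfl⟩ := hs <;> apply Complex.ext <;> simp <;> ring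
  linear_combination y (Sum.inr (0, k), j) * hfac

/-! ### First-order perturbation of the uncoupled eigenvalues. -/

/-- If `δ_i p_i = -ε_i q_i` with `ε_i > 0`, `p_i → c a` and `q_i → c b` for positive reals `a`, `b`
and some `c ≠ 0`, then `Re δ_i` is not asymptotically bounded below by `-o(ε_i)`. -/
theorem not_tendsto_of_first_order {δ p q : ℕ → ℂ} {ε γ : ℕ → ℝ} {c : ℂ} {a b : ℝ} (hc : c ≠ 0)
    (ha : 0 < a) (hb : 0 < b) (hε : ∀ i, 0 < ε i)
    (hp : Tendsto p atTop (𝓝 (c * a))) (hq : Tendsto q atTop (𝓝 (c * b)))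
    (heq : ∀ᶠ i in atTop, δ i * p i = -(ε i * q i))
    (hre : ∀ i, -(γ i * ε i) < (δ i).re) (hγ : Tendsto γ atTop (𝓝 0)) : False := by
  have ha' : (a : ℂ) ≠ 0 := by exact_mod_cast ha.ne'
  have h1 : Tendsto (fun i => (-(q i / p i)).re) atTop (𝓝 (-(b / a))) := by
    have : (-(b / a) : ℝ) = (-(c * b / (c * a)) : ℂ).re := by
      rw [mul_div_mul_left _ _ hc]; norm_cast
    rw [this]
    exact (Complex.continuous_re.tendsto _).comp (hq.div hp (mul_ne_zero hc ha')).neg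
  have h2 : ∀ᶠ i in atTop, -γ i ≤ (-(q i / p i)).re := by
    filter_upwards [heq, hp.eventually_ne (mul_ne_zero hc ha')] with i hi hpi
    have : δ i = (ε i : ℂ) * -(q i / p i) := by
      field_simp
      linear_combination hi
    have h3 := hre i
    rw [this, Complex.re_ofReal_mul] at h3
    nlinarith [hε i]
  have h3 := le_of_tendsto_of_tendsto hγ.neg h1 h2
  have : 0 < b / a := by positivity
  linarith

/-- Eigenvectors of the uncoupled loop for eigenvalues in the closed right half plane: they vanish
on the plant and live on exactly one mode of the regulator. -/
theorem eigenvector_zero_gain {n m r ℓ : ℕ} (P : Plant n m r) (hA : IsHurwitz P.A)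
    {ω : Fin ℓ → ℝ} (hω : StrictMono ω) (hpos : ∀ k, 0 < ω k) {μ : ℂ} (hμ : 0 ≤ μ.re)
    {z : Fin n ⊕ ModeIndex ℓ × Fin r → ℂ} (hz : z ≠ 0)
    (h : (closedLoop P ω 0).map Complex.ofReal *ᵥ z = μ • z) :
    (μ = 0 ∧ (∀ i k j, z (Sum.inr (Sum.inr (i, k), j)) = 0) ∧
      (fun j => z (Sum.inr (Sum.inl 0, j))) ≠ 0) ∨
    ∃ k, (μ = Complex.I * ω k ∨ μ = star (Complex.I * ω k)) ∧
      (∀ j, z (Sum.inr (Sum.inl 0, j)) = 0) ∧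
      (∀ i k', k' ≠ k → ∀ j, z (Sum.inr (Sum.inr (i, k'), j)) = 0) ∧
      (∀ j, z (Sum.inr (Sum.inr (1, k), j)) = μ * z (Sum.inr (Sum.inr (0, k), j))) ∧
      (fun j => z (Sum.inr (Sum.inr (0, k), j))) ≠ 0 := by
  obtain ⟨h1, h2, h3, h4⟩ := closedLoop_eigenvector P ω 0 h (u := 0) (by
    ext i; simp [Matrix.mulVec, dotProduct]) rfl
  have hx : z ∘ Sum.inl = 0 := by
    by_contra hx
    refine (hA μ ?_).not_ge hμ
    rw [mem_spectrum_iff_det_eq_zero, ← Matrix.exists_mulVec_eq_zero_iff]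
    refine ⟨_, hx, ?_⟩
    rw [Matrix.mulVec_zero, sub_zero] at h1
    rw [Matrix.sub_mulVec, Matrix.smul_mulVec, Matrix.one_mulVec, h1, sub_self]
  simp only [hx, Matrix.mulVec_zero, sub_zero, Pi.zero_apply, add_zero] at h2 h4
  -- Each oscillator, reduced to its first coordinate, can be excited only where `μ² = -ω_k²`.
  have h5 : ∀ k j, (μ ^ 2 + (ω k : ℂ) ^ 2) * z (Sum.inr (Sum.inr (0, k), j)) = 0 := by
    intro k j
    linear_combination h4 k j + μ * h3 k j
  by_cases hμ0 : μ = 0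
  · left
    have h6 : ∀ i k j, z (Sum.inr (Sum.inr (i, k), j)) = 0 := by
      intro i k j
      have hk : (ω k : ℂ) ≠ 0 := by exact_mod_cast (hpos k).ne'
      fin_cases i
      · simpa [hμ0, hk] using h5 k j
      · simpa [hμ0] using (h3 k j).symm
    refine ⟨hμ0, h6, fun h7 => hz ?_⟩
    ext p
    rcases p with i | ⟨i | ⟨i, k⟩, j⟩
    · exact congrFun hx i
    · rw [Subsingleton.elim i 0]
      exact congrFun h7 j
    · exact h6 i k j
  · right
    have h6 : ∀ j, z (Sum.inr (Sum.inl 0, j)) = 0 := fun j => by simpa [hμ0] using h2 j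
    obtain ⟨k, hk⟩ : ∃ k, (fun j => z (Sum.inr (Sum.inr (0, k), j))) ≠ 0 := by
      by_contra! h7
      refine hz ?_
      ext p
      rcases p with i | ⟨i | ⟨i, k⟩, j⟩
      · exact congrFun hx i
      · rw [Subsingleton.elim i 0]
        exact h6 j
      · have h8 : z (Sum.inr (Sum.inr (0, k), j)) = 0 := congrFun (h7 k) j
        fin_cases i
        · exact h8
        · simpa [h8] using (h3 k j).symm
    obtain ⟨j, hj⟩ := Function.ne_iff.1 hk
    have h7 : μ ^ 2 + (ω k : ℂ) ^ 2 = 0 := (mul_eq_zero.1 (h5 k j)).resolve_right hj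
    refine ⟨k, ?_, h6, fun i k' hk' j => ?_, fun j => (h3 k j).symm, hk⟩
    · have h8 : (μ - Complex.I * ω k) * (μ + Complex.I * ω k) = 0 := by
        linear_combination h7 - (ω k : ℂ) ^ 2 * Complex.I_sq
      rcases mul_eq_zero.1 h8 with h9 | h9
      · exact Or.inl (sub_eq_zero.1 h9)
      · right
        rw [eq_neg_of_add_eq_zero_left h9]
        simp
    · have h8 : μ ^ 2 + (ω k' : ℂ) ^ 2 ≠ 0 := by
        intro h8
        have h9 : (ω k' : ℂ) ^ 2 = (ω k : ℂ) ^ 2 := by linear_combination h8 - h7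
        have h10 : ω k' ^ 2 = ω k ^ 2 := by exact_mod_cast h9
        exact hk' (hω.injective ((pow_left_inj₀ (hpos k').le (hpos k).le two_ne_zero).1 h10))
      have h9 := (mul_eq_zero.1 (h5 k' j)).resolve_left h8
      fin_cases i
      · exact h9
      · simpa [h9] using (h3 k' j).symm

/-- Covers `ε = 0`, which low-gain stability includes but division by `ε` does not reach. -/
theorem re_le_zero_of_zero_gain {n m r ℓ : ℕ} (P : Plant n m r) (hA : IsHurwitz P.A)
    {ω : Fin ℓ → ℝ} (hω : StrictMono ω) (hpos : ∀ k, 0 < ω k) {μ : ℂ}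
    {z : Fin n ⊕ ModeIndex ℓ × Fin r → ℂ} (hz : z ≠ 0)
    (h : (closedLoop P ω 0).map Complex.ofReal *ᵥ z = μ • z) : μ.re ≤ 0 := by
  by_contra! hμ
  obtain ⟨rfl, -⟩ | ⟨k, rfl | rfl, -⟩ := eigenvector_zero_gain P hA hω hpos hμ.le hz h <;>
    simp at hμ

theorem continuous_closedLoop {n m r ℓ : ℕ} (P : Plant n m r) (ω : Fin ℓ → ℝ) :
    Continuous (closedLoop P ω) := by
  unfold closedLoop
  exact Continuous.matrix_fromBlocks (by fun_prop) (by fun_prop) (by fun_prop) (by fun_prop)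

/-- Compactness of normalized eigenpairs along a convergent sequence of matrices. -/
theorem exists_tendsto_eigenpair {ι : Type*} [Fintype ι] [DecidableEq ι] {M : ℕ → Matrix ι ι ℂ}
    {M₀ : Matrix ι ι ℂ} (hM : Tendsto M atTop (𝓝 M₀)) {μ : ℕ → ℂ} {v : ℕ → ι → ℂ}
    (hv : ∀ i, ‖v i‖ = 1) (h : ∀ i, M i *ᵥ v i = μ i • v i) :
    ∃ φ : ℕ → ℕ, StrictMono φ ∧ ∃ μ₀ v₀, Tendsto (μ ∘ φ) atTop (𝓝 μ₀) ∧
      Tendsto (v ∘ φ) atTop (𝓝 v₀) ∧ v₀ ≠ 0 ∧ M₀ *ᵥ v₀ = μ₀ • v₀ := by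
  -- The operator norm induced by the sup norm on vectors bounds every eigenvalue.
  let _ : NormedRing (Matrix ι ι ℂ) := Matrix.linftyOpNormedRing
  obtain ⟨C, hC⟩ := (Metric.isBounded_range_of_tendsto M hM).exists_norm_le
  have hμ : ∀ i, ‖μ i‖ ≤ C := fun i => by
    have h1 := Matrix.linfty_opNorm_mulVec (M i) (v i)
    rw [h, norm_smul, hv, mul_one, mul_one] at h1
    exact h1.trans (hC _ ⟨i, rfl⟩)
  obtain ⟨⟨μ₀, v₀⟩, -, φ, hφ, hlim⟩ :=
    ((isCompact_closedBall (0 : ℂ) C).prod (isCompact_closedBall (0 : ι → ℂ) 1)).tendsto_subseq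
      (x := fun i => (μ i, v i)) fun i => ⟨by simpa using hμ i, by simp [hv]⟩
  have hμ₀ : Tendsto (μ ∘ φ) atTop (𝓝 μ₀) := (continuous_fst.tendsto _).comp hlim
  have hv₀ : Tendsto (v ∘ φ) atTop (𝓝 v₀) := (continuous_snd.tendsto _).comp hlim
  refine ⟨φ, hφ, μ₀, v₀, hμ₀, hv₀, ?_, ?_⟩
  · have h1 : Tendsto (fun _ : ℕ => (1 : ℝ)) atTop (𝓝 ‖v₀‖) := by
      simpa only [Function.comp_def, hv] using hv₀.norm
    have h2 : ‖v₀‖ = 1 := tendsto_nhds_unique h1 tendsto_const_nhds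
    rintro rfl
    simp at h2
  · have h1 := tendsto_mulVec (hM.comp hφ.tendsto_atTop) hv₀
    have h2 : Tendsto (fun i => M (φ i) *ᵥ v (φ i)) atTop (𝓝 (μ₀ • v₀)) := by
      simp only [h]
      exact hμ₀.smul hv₀
    exact tendsto_nhds_unique h1 h2

/-- A sequence of eigenpairs of the closed loop with vanishing gain cannot approach the closed
right half plane faster than the gain. -/
theorem no_slow_eigenpairs {n m r ℓ : ℕ} (P : Plant n m r) (hA : IsHurwitz P.A)
    {ω : Fin ℓ → ℝ} (hω : StrictMono ω) (hpos : ∀ k, 0 < ω k)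
    (hrank : ∀ k, (P.transfer (exoEigenvalue ω k)).rank = r)
    {ε γ : ℕ → ℝ} (hε : ∀ i, 0 < ε i) (hε0 : Tendsto ε atTop (𝓝 0))
    (hγ : Tendsto γ atTop (𝓝 0)) {μ : ℕ → ℂ} (hμ : ∀ i, -(γ i * ε i) < (μ i).re)
    {μ₀ : ℂ} (hμ₀ : Tendsto μ atTop (𝓝 μ₀))
    {z : ℕ → Fin n ⊕ ModeIndex ℓ × Fin r → ℂ} {z₀ : Fin n ⊕ ModeIndex ℓ × Fin r → ℂ}
    (hz : Tendsto z atTop (𝓝 z₀)) (hz₀ : z₀ ≠ 0)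
    (h : ∀ i, (closedLoop P ω
      (ε i • sampleGain ω fun k => P.transfer (exoEigenvalue ω k))).map Complex.ofReal *ᵥ z i =
        μ i • z i)
    (h₀ : (closedLoop P ω 0).map Complex.ofReal *ᵥ z₀ = μ₀ • z₀) : False := by
  set H := fun k => P.transfer (exoEigenvalue ω k) with hH
  set K := sampleGain ω H with hK
  have hre : 0 ≤ μ₀.re := by
    have h1 : Tendsto (fun i => -(γ i * ε i)) atTop (𝓝 0) := by
      simpa using (hγ.mul hε0).neg
    exact le_of_tendsto_of_tendsto' h1 ((Complex.continuous_re.tendsto _).comp hμ₀)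
      fun i => (hμ i).le
  have hreg : ∀ s : ℂ, 0 ≤ s.re → s ∉ spectrum ℂ (P.A.map Complex.ofReal) :=
    fun s hs hmem => (hA s hmem).not_ge hs
  have hcont := P.continuousAt_transfer (hreg μ₀ hre)
  have hev : ∀ᶠ i in atTop, μ i ∉ spectrum ℂ (P.A.map Complex.ofReal) :=
    hμ₀.eventually ((isOpen_resolventSet_matrix _).mem_nhds (hreg μ₀ hre))
  set u : ℕ → Fin m → ℂ := fun i => K.map Complex.ofReal *ᵥ (z i ∘ Sum.inr) with hu
  have hlim : Tendsto (fun i => P.transfer (μ i) *ᵥ u i) atTop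
      (𝓝 (P.transfer μ₀ *ᵥ (K.map Complex.ofReal *ᵥ (z₀ ∘ Sum.inr)))) := by
    have hzr : Tendsto (fun i => z i ∘ Sum.inr) atTop (𝓝 (z₀ ∘ Sum.inr)) :=
      ((Pi.continuous_precomp Sum.inr).tendsto z₀).comp hz
    exact tendsto_mulVec (hcont.tendsto.comp hμ₀) (tendsto_mulVec tendsto_const_nhds hzr)
  -- Near `μ₀` the resolvent of `A` exists, so the plant state can be eliminated exactly, not just
  -- to first order.
  have heqs : ∀ᶠ i in atTop,
      (∀ j, μ i * z i (Sum.inr (Sum.inl 0, j)) = -(ε i * (P.transfer (μ i) *ᵥ u i) j)) ∧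
      (∀ k j, (μ i ^ 2 + (ω k : ℂ) ^ 2) * z i (Sum.inr (Sum.inr (0, k), j)) =
        -(ε i * (P.transfer (μ i) *ᵥ u i) j)) := by
    filter_upwards [hev] with i hi
    obtain ⟨h1, h2, h3, h4⟩ := closedLoop_eigenvector P ω _ (h i) (u := (ε i : ℂ) • u i) (by
      rw [hu, ← Matrix.smul_mulVec]; congr 1; ext; simp) rfl
    rw [P.output_eq hi h1, Matrix.mulVec_smul] at h2 h4
    simp only [Pi.neg_apply, Pi.smul_apply, smul_eq_mul] at h2 h4
    exact ⟨h2, fun k j => by linear_combination h4 k j + μ i * h3 k j⟩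
  have hdot : ∀ w : Fin r → ℂ, Tendsto (fun i => star w ⬝ᵥ (P.transfer (μ i) *ᵥ u i)) atTop
      (𝓝 (star w ⬝ᵥ (P.transfer μ₀ *ᵥ (K.map Complex.ofReal *ᵥ (z₀ ∘ Sum.inr))))) := fun w =>
    ((show Continuous fun v : Fin r → ℂ => star w ⬝ᵥ v by fun_prop).tendsto _).comp hlim
  have hadj : ∀ (N : Matrix (Fin r) (Fin m) ℂ) (w : Fin r → ℂ),
      star w ⬝ᵥ (N *ᵥ (Nᴴ *ᵥ w)) = star (Nᴴ *ᵥ w) ⬝ᵥ (Nᴴ *ᵥ w) := by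
    intro N w
    rw [Matrix.dotProduct_mulVec, Matrix.star_mulVec, Matrix.conjTranspose_conjTranspose]
  rcases eigenvector_zero_gain P hA hω hpos hre hz₀ h₀ with
    ⟨hμ0, hy, hw⟩ | ⟨k, hμk, hy0, hy, hy1, hw⟩
  · set w : Fin r → ℂ := fun j => z₀ (Sum.inr (Sum.inl 0, j)) with hwdef
    have hN : P.transfer μ₀ = H 0 := by rw [hμ0]; rfl
    have hreal : (H 0).map star = H 0 := by
      have := P.transfer_star 0
      rw [star_zero] at this
      exact this.symm
    have hKz : K.map Complex.ofReal *ᵥ (z₀ ∘ Sum.inr) = (H 0)ᴴ *ᵥ w :=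
      sampleGain_mulVec_constant ω H hreal hy
    obtain ⟨a, ha, ha'⟩ := star_dotProduct_self_pos hw
    obtain ⟨b, hb, hb'⟩ := star_dotProduct_self_pos
      fun h0 => hw (eq_zero_of_conjTranspose_mulVec (hrank 0) h0)
    have hq := hdot w
    rw [hKz, hN, hadj, hb'] at hq
    have hp : Tendsto (fun i => star w ⬝ᵥ fun j => z i (Sum.inr (Sum.inl 0, j))) atTop
        (𝓝 (a : ℂ)) := by
      rw [← ha']
      exact ((show Continuous fun v : Fin n ⊕ ModeIndex ℓ × Fin r → ℂ =>
        star w ⬝ᵥ fun j => v (Sum.inr (Sum.inl 0, j)) by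
          unfold dotProduct; fun_prop).tendsto _).comp hz
    refine not_tendsto_of_first_order (c := 1) one_ne_zero ha hb hε (by simpa using hp)
      (by simpa using hq) ?_ hμ hγ
    filter_upwards [heqs] with i hi
    simp only [dotProduct, Finset.mul_sum, ← Finset.sum_neg_distrib]
    exact Finset.sum_congr rfl fun j _ => by linear_combination star w j * hi.1 j
  · set w : Fin r → ℂ := fun j => z₀ (Sum.inr (Sum.inr (0, k), j)) with hwdef
    have hωk : (ω k : ℂ) ≠ 0 := by exact_mod_cast (hpos k).ne'
    have hre0 : μ₀.re = 0 := by rcases hμk with h1 | h1 <;> simp [h1]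
    have hsq : μ₀ ^ 2 = -(ω k : ℂ) ^ 2 := by
      rcases hμk with h1 | h1 <;> simp [h1, mul_pow]
    have hne : 2 * μ₀ ≠ 0 := by
      refine mul_ne_zero two_ne_zero fun h1 => hωk ?_
      rw [h1] at hsq
      simpa using hsq
    have hN : μ₀ = Complex.I * ω k ∧ P.transfer μ₀ = H k.succ ∨
        μ₀ = star (Complex.I * ω k) ∧ P.transfer μ₀ = (H k.succ).map star := by
      refine hμk.imp (fun h1 => ⟨h1, ?_⟩) fun h1 => ⟨h1, ?_⟩
      · rw [h1]; rfl
      · rw [h1, P.transfer_star]; rfl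
    have hrk : (P.transfer μ₀).rank = r := by
      rcases hN with ⟨-, h1⟩ | ⟨-, h1⟩
      · rw [h1]; exact hrank k.succ
      · rw [h1, rank_map_star]; exact hrank k.succ
    have hKz : K.map Complex.ofReal *ᵥ (z₀ ∘ Sum.inr) =
        (2 * μ₀) • ((P.transfer μ₀)ᴴ *ᵥ w) :=
      sampleGain_mulVec_oscillator ω H k hN hy0 hy hy1
    obtain ⟨a, ha, ha'⟩ := star_dotProduct_self_pos hw
    obtain ⟨b, hb, hb'⟩ := star_dotProduct_self_pos
      fun h0 => hw (eq_zero_of_conjTranspose_mulVec hrk h0)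
    have hq := hdot w
    rw [hKz, Matrix.mulVec_smul, dotProduct_smul, hadj, hb', smul_eq_mul] at hq
    -- Here `μᵢ² + ω_k² = (μᵢ - μ₀)(μᵢ + μ₀)`. The second factor tends to `2μ₀`, the same constant
    -- that the gain puts on the right-hand side.
    have hp : Tendsto (fun i => (μ i + μ₀) *
        (star w ⬝ᵥ fun j => z i (Sum.inr (Sum.inr (0, k), j)))) atTop
        (𝓝 (2 * μ₀ * (a : ℂ))) := by
      rw [← ha', two_mul]
      exact (hμ₀.add_const μ₀).mul (((show Continuous fun v : Fin n ⊕ ModeIndex ℓ × Fin r → ℂ =>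
        star w ⬝ᵥ fun j => v (Sum.inr (Sum.inr (0, k), j)) by
          unfold dotProduct; fun_prop).tendsto _).comp hz)
    refine not_tendsto_of_first_order (δ := fun i => μ i - μ₀) hne ha hb hε hp hq ?_
      (fun i => by simpa [hre0] using hμ i) hγ
    filter_upwards [heqs] with i hi
    simp only [dotProduct, Finset.mul_sum, ← Finset.sum_neg_distrib]
    exact Finset.sum_congr rfl fun j _ => by
      linear_combination star w j * hi.2 k j -
        star w j * z i (Sum.inr (Sum.inr (0, k), j)) * hsq

/-! ### Compactness argument and conclusion. -/

theorem lowGainHurwitz_sampleGain {n m r ℓ : ℕ} (P : Plant n m r) (hA : IsHurwitz P.A)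
    {ω : Fin ℓ → ℝ} (hω : StrictMono ω) (hpos : ∀ k, 0 < ω k)
    (hrank : ∀ k, (P.transfer (exoEigenvalue ω k)).rank = r) :
    LowGainHurwitz fun ε => closedLoop P ω
      ((ε : ℝ) • sampleGain ω fun k => P.transfer (exoEigenvalue ω k)) := by
  have hcont : Continuous fun ε : ℝ => closedLoop P ω
      (ε • sampleGain ω fun k => P.transfer (exoEigenvalue ω k)) :=
    (continuous_closedLoop P ω).comp (by fun_prop)
  refine ⟨hcont.comp NNReal.continuous_coe, ?_⟩
  by_contra! hbad
  have hstep : ∀ i : ℕ, ∃ ε : ℝ≥0, ∃ μ : ℂ, ∃ z : Fin n ⊕ ModeIndex ℓ × Fin r → ℂ,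
      (ε : ℝ) ≤ 1 / ((i : ℝ) + 1) ∧ 0 < (ε : ℝ) ∧ -(1 / ((i : ℝ) + 1) * ε) < μ.re ∧ ‖z‖ = 1 ∧
      (closedLoop P ω ((ε : ℝ) • sampleGain ω fun k => P.transfer (exoEigenvalue ω k))).map
        Complex.ofReal *ᵥ z = μ • z := by
    intro i
    -- Both candidate constants `c` and `ε*` shrink together, forcing `εᵢ → 0` and `Re μᵢ ≥ -o(εᵢ)`.
    obtain ⟨ε, hε, h1⟩ := hbad (1 / ((i : ℝ) + 1)) (by positivity) (1 / ((i : ℝ≥0) + 1))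
      (by positivity)
    simp only [spectralAbscissa, lt_iSup_iff] at h1
    obtain ⟨μ, hμ, h2⟩ := h1
    rw [EReal.coe_lt_coe_iff] at h2
    obtain ⟨z, hz, h3⟩ := exists_eigenvector_of_mem_spectrum hμ
    refine ⟨ε, μ, z, by exact_mod_cast hε.le, ?_, h2, hz, h3⟩
    rw [NNReal.coe_pos]
    refine pos_of_ne_zero fun h0 => ?_
    subst h0
    rw [NNReal.coe_zero, zero_smul] at h3
    have hz0 : z ≠ 0 := by
      rintro rfl
      simp at hz
    have := re_le_zero_of_zero_gain P hA hω hpos hz0 h3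
    simp at h2
    linarith
  choose ε μ z hε hε0 hμ hz h using hstep
  have hγ : Tendsto (fun i : ℕ => 1 / ((i : ℝ) + 1)) atTop (𝓝 0) :=
    tendsto_one_div_add_atTop_nhds_zero_nat
  have hεlim : Tendsto (fun i => (ε i : ℝ)) atTop (𝓝 0) :=
    squeeze_zero (fun i => (hε0 i).le) hε hγ
  have hM : Tendsto (fun i => (closedLoop P ω ((ε i : ℝ) • sampleGain ω
      fun k => P.transfer (exoEigenvalue ω k))).map Complex.ofReal) atTop
      (𝓝 ((closedLoop P ω 0).map Complex.ofReal)) := by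
    have h1 := ((hcont.matrix_map Complex.continuous_ofReal).tendsto 0).comp hεlim
    rwa [zero_smul] at h1
  obtain ⟨φ, hφ, μ₀, z₀, hμ₀, hz₀, hne, h₀⟩ := exists_tendsto_eigenpair hM hz h
  exact no_slow_eigenpairs P hA hω hpos hrank (fun i => hε0 (φ i))
    (hεlim.comp hφ.tendsto_atTop) (hγ.comp hφ.tendsto_atTop) (fun i => hμ (φ i)) hμ₀ hz₀ hne
    (fun i => h (φ i)) h₀

open scoped Matrix.Norms.L2Operator in
theorem isLowGain_smul {ι κ : Type*} [Fintype ι] [Fintype κ] [DecidableEq κ]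
    (K : Matrix ι κ ℝ) : IsLowGain fun ε : ℝ≥0 => (ε : ℝ) • K := by
  refine ⟨by fun_prop, ‖K‖, tendsto_const_nhds.congr' ?_⟩
  filter_upwards [self_mem_nhdsWithin] with ε hε
  have hε' : (0 : ℝ) < ε := hε
  rw [norm_smul, Real.norm_of_nonneg hε'.le, mul_div_cancel_left₀ _ hε'.ne']

end SGTR

theorem mainTheorem3 {n m r ℓ nw : ℕ} (P : SGTR.Plant n m r) (hA : SGTR.IsHurwitz P.A)
    (S : Matrix (Fin nw) (Fin nw) ℝ) (ω : Fin ℓ → ℝ) (hω : StrictMono ω) (hpos : ∀ k, 0 < ω k)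
    (hS : minpoly ℝ S = SGTR.exoPolynomial ω)
    (hrank : ∀ μ ∈ spectrum ℂ (S.map Complex.ofReal), (P.transfer μ).rank = r) :
    SGTR.ProblemSolvable ω (fun k => P.transfer (SGTR.exoEigenvalue ω k)) := by
  refine ⟨_, SGTR.isLowGain_smul
    (SGTR.sampleGain ω fun k => P.transfer (SGTR.exoEigenvalue ω k)), fun n' P' hA' hP' => ?_⟩
  -- Equal samples mean that this gain is also the one built from `P'`, and the rank condition
  -- carries over.
  have hsamples : (fun k => P.transfer (SGTR.exoEigenvalue ω k)) =
      fun k => P'.transfer (SGTR.exoEigenvalue ω k) := funext fun k => (hP' k).symm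
  rw [hsamples]
  refine SGTR.lowGainHurwitz_sampleGain P' hA' hω hpos fun k => ?_
  rw [hP' k]
  exact hrank _ (SGTR.mem_spectrum_of_isRoot_minpoly (hS ▸ SGTR.aeval_exoEigenvalue ω k))
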